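/- Let $S^1=\mathbb{R}/\mathbb{Z}$ and let $f:S^1\to S^1$ be an orientation-preserving homeomorphism whose rotation number is irrational. For points $a<b<c<d$ put $$(a,b,c,d)=\frac{(c-b)(d-a)}{(b-a)(d-c)},$$ and define the variation of the logarithm of the cross ratio distortion under $f$ as $$V(f)=\sup_{\{x_0,\dots,x_n\}}\ \sum_{i=0}^{n-1}\ \sup_{b_i,c_i}\ \log\frac{(f(x_i),f(b_i),f(c_i),f(x_{i+1}))}{(x_i,b_i,c_i,x_{i+1})},$$ where the outer supremum is over all $n\ge 1$ and all partitions of $S^1$ by points $x_0,x_1,\dots,x_n=x_0$ listed counterclockwise around the circle once, the inner supremum is over all pairs of points $b_i,c_i$ such that $x_i,b_i,c_i,x_{i+1}$ follow each other counterclockwise in the arc from $x_i$ to $x_{i+1}$, and differences of points stand for lengths of counterclockwise arcs (that is, cross ratios are computed on the line, using a lift of $f$ to $\mathbb{R}$). If $V(f)\le B$ for some real number $B$, then $f$ has no wandering interval, that is, there is no nondegenerate interval $J\subset S^1$ such that $f^k(J)\cap J=\emptyset$ for all $k\in\mathbb{Z}\setminus\{0\}$; and $f$ is topologically conjugate to an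 irrational rigid rotation, that is, there are an irrational $\alpha$ and a homeomorphism $h:S^1\to S^1$ such that $h(f(x))=h(x)+\alpha$ for all $x\in S^1$. -/

import Mathlib

noncomputable section

namespace CircleHomeo

/-- `F` is a continuous increasing lift to the line of the homeomorphism `f` of the circle
`ℝ / ℤ`. (Elements of `CircleDeg1Lift` are the monotone maps `F` with `F (x + 1) = F x + 1`.) -/
structure IsLift (F : CircleDeg1Lift) (f : UnitAddCircle ≃ₜ UnitAddCircle) : Prop where
  continuous : Continuous F
  coe_apply : ∀ x : ℝ, ((F x : ℝ) : UnitAddCircle) = f (x : UnitAddCircle)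

/-- A circle homeomorphism preserves the orientation if it has an increasing lift to the line. -/
def OrientationPreserving (f : UnitAddCircle ≃ₜ UnitAddCircle) : Prop :=
  ∃ F : CircleDeg1Lift, IsLift F f

/-- Two lifts of the same homeomorphism differ by an integer. -/
theorem IsLift.exists_int {F G : CircleDeg1Lift} {f : UnitAddCircle ≃ₜ UnitAddCircle}
    (hF : IsLift F f) (hG : IsLift G f) : ∃ m : ℤ, ∀ x, G x = F x + m := by
  have key : ∀ x, ∃ m : ℤ, (m : ℝ) = G x - F x := by
    intro x
    have h : ((G x - F x : ℝ) : UnitAddCircle) = 0 := by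
      rw [AddCircle.coe_sub, hG.coe_apply, hF.coe_apply, sub_self]
    obtain ⟨m, hm⟩ := (AddCircle.coe_eq_zero_iff (1 : ℝ)).1 h
    exact ⟨m, by simpa using hm⟩
  choose m hm using key
  have hc : Continuous m := by
    have h1 : Continuous fun x => ((m x : ℤ) : ℝ) := by
      simp only [hm]
      exact hG.continuous.sub hF.continuous
    exact Int.isClosedEmbedding_coe_real.isEmbedding.continuous_iff.2 h1
  refine ⟨m 0, fun x => ?_⟩
  have h2 : m x = m 0 := PreconnectedSpace.constant inferInstance hc
  have h3 := hm x
  rw [h2] at h3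
  linarith

/-- The rotation number, an element of `ℝ / ℤ`: the class of the translation number
`lim (F^n x - x) / n` of a lift `F`. -/
def rotationNumber (f : UnitAddCircle ≃ₜ UnitAddCircle) (hf : OrientationPreserving f) :
    UnitAddCircle :=
  ((CircleDeg1Lift.translationNumber hf.choose : ℝ) : UnitAddCircle)

/-- The rotation number can be computed with any lift. -/
theorem rotationNumber_eq {F : CircleDeg1Lift} {f : UnitAddCircle ≃ₜ UnitAddCircle}
    (hf : OrientationPreserving f) (hF : IsLift F f) :
    rotationNumber f hf = ((CircleDeg1Lift.translationNumber F : ℝ) : UnitAddCircle) := by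
  obtain ⟨m, hm⟩ := hF.exists_int hf.choose_spec
  have h : hf.choose =
      (CircleDeg1Lift.translate (Multiplicative.ofAdd (m : ℝ)) : CircleDeg1Lift) * F := by
    ext x
    rw [hm x, CircleDeg1Lift.mul_apply, CircleDeg1Lift.translate_apply, add_comm]
  have hcomm : Commute
      (CircleDeg1Lift.translate (Multiplicative.ofAdd (m : ℝ)) : CircleDeg1Lift) F := by
    rw [CircleDeg1Lift.commute_iff_commute]
    intro x
    simp
  rw [rotationNumber, h, CircleDeg1Lift.translationNumber_mul_of_commute hcomm,
    CircleDeg1Lift.translationNumber_translate, AddCircle.coe_add]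
  have h0 : ((m : ℝ) : UnitAddCircle) = 0 :=
    (AddCircle.coe_eq_zero_iff (1 : ℝ)).2 ⟨m, by simp⟩
  simp [h0]

/-- A point of `ℝ / ℤ` is irrational if it is the class of an irrational number. -/
def IsIrrational (θ : UnitAddCircle) : Prop :=
  ∃ α : ℝ, Irrational α ∧ (α : UnitAddCircle) = θ

/-- The cross ratio `(a, b, c, d)` of four points `a < b < c < d`. -/
def crossRatio (a b c d : ℝ) : ℝ :=
  ((c - b) * (d - a)) / ((b - a) * (d - c))

/-- The logarithm of the cross ratio distortion under `F`. -/
def logDistortion (F : ℝ → ℝ) (a b c d : ℝ) : ℝ :=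
  Real.log (crossRatio (F a) (F b) (F c) (F d) / crossRatio a b c d)

/-- The supremum of the logarithm of the cross ratio distortion over the 4-tuples with
extreme points `a` and `d`. -/
def supLogDistortion (F : ℝ → ℝ) (a d : ℝ) : EReal :=
  ⨆ (b : ℝ) (c : ℝ) (_ : a < b ∧ b < c ∧ c < d), ((logDistortion F a b c d : ℝ) : EReal)

/-- A partition of the circle into `n` arcs, as lifted to the line: the division points are
listed counterclockwise, and the last one is the first one after one full turn. -/
def IsCirclePartition (n : ℕ) (x : Fin (n + 1) → ℝ) : Prop :=
  StrictMono x ∧ x (Fin.last n) = x 0 + 1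

/-- The variation over the circle of the logarithm of the cross ratio distortion under a lift. -/
def liftVariation (F : ℝ → ℝ) : EReal :=
  ⨆ (n : ℕ) (x : Fin (n + 1) → ℝ) (_ : IsCirclePartition n x),
    ∑ i : Fin n, supLogDistortion F (x i.castSucc) (x i.succ)

/-- The variation of the logarithm of the cross ratio distortion under an orientation preserving
circle homeomorphism. Lengths of arcs are measured on the line, through a lift. -/
def logCrossRatioVariation (f : UnitAddCircle ≃ₜ UnitAddCircle)
    (hf : OrientationPreserving f) : EReal :=
  liftVariation hf.choose

/-- The variation can be computed with any lift. -/
theorem logCrossRatioVariation_eq {F : CircleDeg1Lift} {f : UnitAddCircle ≃ₜ UnitAddCircle}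
    (hf : OrientationPreserving f) (hF : IsLift F f) :
    logCrossRatioVariation f hf = liftVariation F := by
  obtain ⟨m, hm⟩ := hF.exists_int hf.choose_spec
  simp only [logCrossRatioVariation, liftVariation, supLogDistortion, logDistortion, crossRatio,
    hm, add_sub_add_right_eq_sub]

/-- A wandering interval: a nondegenerate interval `J` of the circle (open, closed or half-open)
which is disjoint from all its images under the nontrivial iterates of `f`. -/
def IsWanderingInterval (f : UnitAddCircle ≃ₜ UnitAddCircle) (J : Set UnitAddCircle) : Prop :=
  (∃ I : Set ℝ, I.OrdConnected ∧ I.Nontrivial ∧ J = (fun t : ℝ => (t : UnitAddCircle)) '' I) ∧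
    ∀ k : ℤ, k ≠ 0 → Disjoint ((f ^ k : UnitAddCircle ≃ₜ UnitAddCircle) '' J) J

/-- `f` is topologically conjugate to the rigid rotation by the angle `θ`. -/
def ConjugateToRotation (f : UnitAddCircle ≃ₜ UnitAddCircle) (θ : UnitAddCircle) : Prop :=
  ∃ h : UnitAddCircle ≃ₜ UnitAddCircle, ∀ x, h (f x) = h x + θ

end CircleHomeo

end

namespace CircleHomeo

open Filter Topology

/-! Let `u` be the lift of `f`, with translation number `τ`. A monotone `H` of degree one satisfies
`H ∘ u = H + τ`; it is continuous because `τ` is irrational, so both conclusions follow once `H` is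
injective (`injective_of_liftVariation_le`).

Suppose `H` is constant on `[b, c]`, with `b` the left end of the plateau, and let `p / q`
approximate `τ` within `1 / q ^ 2`. Among the first `q` backward iterates of `[b, c]` take the
shortest. Integer translates of two other iterates lie on its two sides, within `2 / q` as measured
by `H`, and are at least as long, so the cross ratio they span is at most 3. Mapping forward to `[b,
c]` multiplies it by at most `exp (12 * B)`, since the intermediate arcs split into 12 classes of
arcs disjoint on the circle (`sum_logDistortion_zpow_le`). Hence some `a < b` with `H a > H b - 2 /
q` has `b - a` at least a fixed multiple of `c - b` (`exists_definite_space`). As `q` grows, `a`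
must tend to `b`, a contradiction.

The variation controls sums over full partitions only. Disjoint arcs are completed to a partition
without loss because a monotone map is differentiable almost everywhere, and an arc with an endpoint
of differentiability contributes a nonnegative supremum. -/

/-! ### Cross ratios and the sign of the supremum of their distortion. -/

theorem crossRatio_pos {a b c d : ℝ} (hab : a < b) (hbc : b < c) (hcd : c < d) :
    0 < crossRatio a b c d := by
  have h1 := sub_pos.2 hab
  have h2 := sub_pos.2 hbc
  have h3 := sub_pos.2 hcd
  have h4 : 0 < d - a := by linarith
  unfold crossRatio
  positivity

/-- In the projective coordinate `(t - a) / (d - t)` on the arc, cross ratios are ratios of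
coordinates minus one, so bounds on them can be iterated. -/
theorem crossRatio_eq_div_sub_one {a b c d : ℝ} (hab : a < b) (hbc : b < c) (hcd : c < d) :
    crossRatio a b c d = (c - a) / (d - c) / ((b - a) / (d - b)) - 1 := by
  have h1 : b - a ≠ 0 := (sub_pos.2 hab).ne'
  have h3 : d - c ≠ 0 := (sub_pos.2 hcd).ne'
  have h4 : d - b ≠ 0 := (sub_pos.2 (hbc.trans hcd)).ne'
  unfold crossRatio
  field_simp
  ring

theorem logDistortion_eq_sub {F : ℝ → ℝ} (hF : StrictMono F) {a b c d : ℝ} (hab : a < b)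
    (hbc : b < c) (hcd : c < d) :
    logDistortion F a b c d =
      Real.log (crossRatio (F a) (F b) (F c) (F d)) - Real.log (crossRatio a b c d) :=
  Real.log_div (crossRatio_pos (hF hab) (hF hbc) (hF hcd)).ne' (crossRatio_pos hab hbc hcd).ne'

theorem logDistortion_le_sup (F : ℝ → ℝ) {a b c d : ℝ} (hab : a < b) (hbc : b < c)
    (hcd : c < d) : (logDistortion F a b c d : EReal) ≤ supLogDistortion F a d :=
  le_iSup_of_le b <| le_iSup_of_le c <| le_iSup_of_le ⟨hab, hbc, hcd⟩ le_rfl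

/-- Differentiability at an endpoint excludes a definite contraction of cross ratios. -/
theorem supLogDistortion_nonneg_of_differentiableAt_left {F : ℝ → ℝ} (hF : StrictMono F) {y d : ℝ}
    (hy : DifferentiableAt ℝ F y) (hyd : y < d) : 0 ≤ supLogDistortion F y d := by
  by_contra! hneg
  obtain ⟨l, hl, hl0⟩ := EReal.lt_iff_exists_real_btwn.1 hneg
  have hl0 : l < 0 := by exact_mod_cast hl0
  set r := Real.exp l with hr
  have hr1 : r < 1 := by simpa [hr] using hl0
  have hr0 : 0 < r := Real.exp_pos l
  have hdy : 0 < d - y := sub_pos.2 hyd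
  -- The points with projective coordinate `2⁻ⁿ`: consecutive ones form a cross ratio equal to 1.
  -- Distortion below `r < 1` makes the image coordinate `U (t n)` decay no faster than `(1 + r)⁻ⁿ`,
  -- while differentiability at `y` forces `O(2⁻ⁿ)`.
  set t : ℕ → ℝ := fun n => y + (d - y) / (1 + 2 ^ n) with ht
  set U : ℝ → ℝ := fun s => (F s - F y) / (F d - F s) with hU
  have hyt : ∀ n, y < t n := fun n => by
    have : 0 < (d - y) / (1 + 2 ^ n) := by positivity
    simp only [ht]; linarith
  have htlt : ∀ n, t (n + 1) < t n := fun n => by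
    have h2 : (0 : ℝ) < 2 ^ n := by positivity
    have : (d - y) / (1 + 2 ^ (n + 1)) < (d - y) / (1 + 2 ^ n) := by
      apply div_lt_div_of_pos_left hdy (by positivity)
      rw [pow_succ]; linarith
    simp only [ht]; linarith
  have htanti : Antitone t := antitone_nat_of_succ_le fun n => (htlt n).le
  have ht0 : t 0 < d := by simp only [ht]; norm_num; linarith
  have htd : ∀ n, t n < d := fun n => (htanti (Nat.zero_le n)).trans_lt ht0
  have hU0 : ∀ n, 0 < U (t n) := fun n =>
    div_pos (sub_pos.2 (hF (hyt n))) (sub_pos.2 (hF (htd n)))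
  have hu : ∀ n, (t n - y) / (d - t n) = 1 / 2 ^ n := fun n => by
    have h2 : (0 : ℝ) < 2 ^ n := by positivity
    have e1 : t n - y = (d - y) / (1 + 2 ^ n) := by simp only [ht]; ring
    have e2 : d - t n = (d - y) * 2 ^ n / (1 + 2 ^ n) := by
      simp only [ht]; field_simp; ring
    rw [e1, e2]; field_simp
  have hstep : ∀ n, U (t n) ≤ (1 + r) * U (t (n + 1)) := fun n => by
    have h1 : logDistortion F y (t (n + 1)) (t n) d ≤ l := by
      have := (logDistortion_le_sup F (hyt (n + 1)) (htlt n) (htd n)).trans hl.le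
      exact_mod_cast this
    have hpos := crossRatio_pos (hF (hyt (n + 1))) (hF (htlt n)) (hF (htd n))
    have h2 : crossRatio y (t (n + 1)) (t n) d = 1 := by
      rw [crossRatio_eq_div_sub_one (hyt (n + 1)) (htlt n) (htd n), hu, hu, pow_succ]
      field_simp; norm_num
    rw [logDistortion, h2, div_one, Real.log_le_iff_le_exp hpos,
      crossRatio_eq_div_sub_one (hF (hyt (n + 1))) (hF (htlt n)) (hF (htd n))] at h1
    have h3 : U (t n) / U (t (n + 1)) ≤ 1 + r := by simp only [hU]; linarith
    rwa [div_le_iff₀ (hU0 _)] at h3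
  have hiter : ∀ n, U (t 0) ≤ (1 + r) ^ n * U (t n) := fun n => by
    induction n with
    | zero => simp
    | succ n ih =>
      refine ih.trans ?_
      rw [pow_succ, mul_assoc]
      exact mul_le_mul_of_nonneg_left (hstep n) (by positivity)
  have hpow : Tendsto (fun n : ℕ => (1 / 2 : ℝ) ^ n) atTop (𝓝 0) :=
    tendsto_pow_atTop_nhds_zero_of_lt_one (by norm_num) (by norm_num)
  have htle : ∀ n, t n - y ≤ (d - y) * (1 / 2) ^ n := fun n => by
    have e1 : t n - y = (d - y) / (1 + 2 ^ n) := by simp only [ht]; ring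
    rw [e1, one_div, inv_pow, ← div_eq_mul_inv]
    exact div_le_div_of_nonneg_left hdy.le (by positivity) (by linarith)
  have htend : Tendsto t atTop (𝓝 y) := by
    have h1 : Tendsto (fun n : ℕ => y + (d - y) * (1 / 2 : ℝ) ^ n) atTop (𝓝 y) := by
      simpa using tendsto_const_nhds.add (hpow.const_mul (d - y))
    exact tendsto_of_tendsto_of_tendsto_of_le_of_le tendsto_const_nhds h1
      (fun n => (hyt n).le) (fun n => by have := htle n; simp only; linarith)
  obtain ⟨C, hC⟩ := (hy.isBigO_sub.comp_tendsto htend).bound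
  have hFd : 0 < F d - F (t 0) := sub_pos.2 (hF ht0)
  set K := C / (F d - F (t 0)) * (d - y)
  have hbound : ∀ᶠ n in atTop, U (t 0) ≤ |K| * ((1 + r) / 2) ^ n := by
    filter_upwards [hC] with n hn
    simp only [Function.comp, Real.norm_eq_abs] at hn
    have h1 : F (t n) - F y ≤ |C| * ((d - y) * (1 / 2) ^ n) := by
      have h2 : |t n - y| = t n - y := abs_of_pos (sub_pos.2 (hyt n))
      calc F (t n) - F y ≤ |F (t n) - F y| := le_abs_self _
        _ ≤ C * |t n - y| := hn
        _ ≤ |C| * (t n - y) := by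
          rw [h2]; exact mul_le_mul_of_nonneg_right (le_abs_self C) (sub_pos.2 (hyt n)).le
        _ ≤ _ := mul_le_mul_of_nonneg_left (htle n) (abs_nonneg C)
    have h3 : U (t n) ≤ |C| * ((d - y) * (1 / 2) ^ n) / (F d - F (t 0)) := by
      simp only [hU]
      apply div_le_div₀ (by positivity) h1 hFd
      have := hF.monotone (htanti (Nat.zero_le n))
      linarith
    calc U (t 0) ≤ (1 + r) ^ n * U (t n) := hiter n
      _ ≤ (1 + r) ^ n * (|C| * ((d - y) * (1 / 2) ^ n) / (F d - F (t 0))) :=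
        mul_le_mul_of_nonneg_left h3 (by positivity)
      _ = |K| * ((1 + r) / 2) ^ n := by
        rw [abs_mul, abs_div, abs_of_pos hFd, abs_of_pos hdy, div_pow, div_pow, one_pow]
        field_simp
  have hlim : Tendsto (fun n : ℕ => |K| * ((1 + r) / 2) ^ n) atTop (𝓝 0) := by
    simpa using (tendsto_pow_atTop_nhds_zero_of_lt_one (r := (1 + r) / 2) (by positivity)
      (by linarith)).const_mul |K|
  exact (hU0 0).not_ge (ge_of_tendsto hlim hbound)

theorem logDistortion_neg (F : ℝ → ℝ) (a b c d : ℝ) :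
    logDistortion (fun x => -F (-x)) (-d) (-c) (-b) (-a) = logDistortion F a b c d := by
  simp only [logDistortion, crossRatio, neg_neg]
  congr 2 <;> congr 1 <;> ring

/-- Reflection `x ↦ -x` preserves cross ratios and exchanges the two endpoints. -/
theorem supLogDistortion_nonneg_of_differentiableAt_right {F : ℝ → ℝ} (hF : StrictMono F)
    {a y : ℝ} (hy : DifferentiableAt ℝ F y) (hay : a < y) : 0 ≤ supLogDistortion F a y := by
  have hG : StrictMono fun x => -F (-x) := fun x z hxz => neg_lt_neg (hF (neg_lt_neg hxz))
  have hGy : DifferentiableAt ℝ (fun x => -F (-x)) (-y) := by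
    have h : DifferentiableAt ℝ F (-(-y)) := by rwa [neg_neg]
    exact (h.comp (-y) differentiableAt_id.neg).neg
  refine (supLogDistortion_nonneg_of_differentiableAt_left hG hGy (neg_lt_neg hay)).trans ?_
  refine iSup_le fun b => iSup_le fun c => iSup_le fun h => ?_
  have e := logDistortion_neg F a (-c) (-b) y
  rw [neg_neg, neg_neg] at e
  rw [e]
  exact logDistortion_le_sup F (by linarith) (by linarith) (by linarith)

/-! ### Completing disjoint arcs to partitions. -/

/-- `PartitionSum F x z S`: some partition of `[x, z]` into arcs has total distortion at
least `S`. -/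
inductive PartitionSum (F : ℝ → ℝ) (x : ℝ) : ℝ → ℝ → Prop
  | refl : PartitionSum F x x 0
  | snoc {y z S t : ℝ} : PartitionSum F x y S → y < z → (t : EReal) ≤ supLogDistortion F y z →
      PartitionSum F x z (S + t)

theorem PartitionSum.exists_partition {F : ℝ → ℝ} {x z S : ℝ} (h : PartitionSum F x z S) :
    ∃ (n : ℕ) (p : Fin (n + 1) → ℝ), StrictMono p ∧ p 0 = x ∧ p (Fin.last n) = z ∧
      (S : EReal) ≤ ∑ i : Fin n, supLogDistortion F (p i.castSucc) (p i.succ) := by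
  induction h with
  | refl => exact ⟨0, fun _ => x, by simp [Fin.strictMono_iff_lt_succ], rfl, rfl, by simp⟩
  | @snoc y z S t _ hyz ht ih =>
    obtain ⟨n, p, hp, h0, hl, hS⟩ := ih
    refine ⟨n + 1, Fin.snoc p z, ?_, ?_, by simp, ?_⟩
    · rw [Fin.strictMono_iff_lt_succ]
      intro i
      refine Fin.lastCases ?_ (fun j => ?_) i
      · simpa [hl] using hyz
      · rw [Fin.succ_castSucc, Fin.snoc_castSucc, Fin.snoc_castSucc]
        exact hp j.castSucc_lt_succ
    · rw [← Fin.castSucc_zero, Fin.snoc_castSucc, h0]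
    · rw [Fin.sum_univ_castSucc, EReal.coe_add]
      refine add_le_add (hS.trans_eq ?_) ?_
      · refine Finset.sum_congr rfl fun i _ => ?_
        rw [Fin.succ_castSucc, Fin.snoc_castSucc, Fin.snoc_castSucc]
      · simpa [hl] using ht

theorem PartitionSum.le {F : ℝ → ℝ} {x S B : ℝ} (h : PartitionSum F x (x + 1) S)
    (hB : liftVariation F ≤ B) : S ≤ B := by
  obtain ⟨n, p, hp, h0, hl, hS⟩ := h.exists_partition
  have h1 : (S : EReal) ≤ liftVariation F :=
    le_iSup_of_le n <| le_iSup_of_le p <| le_iSup_of_le ⟨hp, by rw [hl, h0]⟩ hS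
  exact_mod_cast h1.trans hB

theorem PartitionSum.extend {F : ℝ → ℝ} (hF : StrictMono F) {x y z S : ℝ}
    (h : PartitionSum F x y S) (hyz : y ≤ z) : PartitionSum F x z S := by
  rcases hyz.eq_or_lt with rfl | hyz
  · exact h
  have hd : Dense {w | DifferentiableAt ℝ F w} :=
    MeasureTheory.Measure.dense_of_ae hF.monotone.ae_differentiableAt
  -- The gap is cut at a point of differentiability, so that each half has a good endpoint.
  obtain ⟨w, hw, hyw, hwz⟩ := hd.exists_between hyz
  have h1 := (h.snoc (t := 0) hyw
    (supLogDistortion_nonneg_of_differentiableAt_right hF hw hyw)).snoc (t := 0) hwz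
    (supLogDistortion_nonneg_of_differentiableAt_left hF hw hwz)
  simpa using h1

theorem partitionSum_of_disjoint {ι : Type*} {F : ℝ → ℝ} (hF : StrictMono F)
    (a b c d : ι → ℝ) (x : ℝ) (A : Finset ι) :
    ∀ z, x ≤ z → (∀ k ∈ A, a k < b k ∧ b k < c k ∧ c k < d k) → (∀ k ∈ A, x ≤ a k) →
      (∀ k ∈ A, d k ≤ z) → (∀ k ∈ A, ∀ k' ∈ A, k ≠ k' → d k ≤ a k' ∨ d k' ≤ a k) →
      PartitionSum F x z (∑ k ∈ A, logDistortion F (a k) (b k) (c k) (d k)) := by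
  classical
  -- Removing the arc with the largest left endpoint leaves all the others to its left.
  induction A using Finset.induction_on_max_value a with
  | empty =>
    intro z hxz _ _ _ _
    simpa using PartitionSum.refl.extend hF hxz
  | insert k0 A hk0 hmax ih =>
    intro z hxz hlt hx hz hdis
    have hk := hlt k0 (Finset.mem_insert_self _ _)
    have h1 := ih (a k0) (hx k0 (Finset.mem_insert_self _ _))
      (fun k h => hlt k (Finset.mem_insert_of_mem h))
      (fun k h => hx k (Finset.mem_insert_of_mem h))
      (fun k h => by
        rcases hdis k (Finset.mem_insert_of_mem h) k0 (Finset.mem_insert_self _ _)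
          (fun e => hk0 (e ▸ h)) with h2 | h2
        · exact h2
        · have := hmax k h
          linarith)
      (fun k h k' h' => hdis k (Finset.mem_insert_of_mem h) k' (Finset.mem_insert_of_mem h'))
    rw [Finset.sum_insert hk0, add_comm]
    exact (h1.snoc (by linarith) (logDistortion_le_sup F hk.1 hk.2.1 hk.2.2)).extend hF
      (hz k0 (Finset.mem_insert_self _ _))

/-- The total distortion over a finite family of arcs which are disjoint on the circle. -/
theorem sum_logDistortion_le_of_disjoint {ι : Type*} {F : ℝ → ℝ} (hF : StrictMono F) {B : ℝ}
    (hB : liftVariation F ≤ B) (a b c d : ι → ℝ) (A : Finset ι)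
    (hlt : ∀ k ∈ A, a k < b k ∧ b k < c k ∧ c k < d k)
    (hwrap : ∀ k ∈ A, ∀ k' ∈ A, d k ≤ a k' + 1)
    (hdis : ∀ k ∈ A, ∀ k' ∈ A, k ≠ k' → d k ≤ a k' ∨ d k' ≤ a k) :
    ∑ k ∈ A, logDistortion F (a k) (b k) (c k) (d k) ≤ B := by
  obtain ⟨x, hx, hx'⟩ : ∃ x, (∀ k ∈ A, x ≤ a k) ∧ ∀ k ∈ A, d k ≤ x + 1 := by
    rcases A.eq_empty_or_nonempty with rfl | hA
    · exact ⟨0, by simp, by simp⟩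
    · obtain ⟨k0, hk0, hmin⟩ := A.exists_min_image a hA
      exact ⟨a k0, hmin, fun k hk => hwrap k hk k0 hk0⟩
  exact (partitionSum_of_disjoint hF a b c d x A (x + 1) (by linarith) hlt hx hx' hdis).le hB

/-! ### Iterates under the semiconjugacy and rational approximation of the rotation number. -/

theorem strictMono_unit (u : CircleDeg1Liftˣ) : StrictMono u :=
  (CircleDeg1Lift.toOrderIso u).strictMono

theorem semiconj_zpow {u : CircleDeg1Liftˣ} {H : CircleDeg1Lift} {τ : ℝ}
    (hH : ∀ x, H (u x) = H x + τ) (n : ℤ) (x : ℝ) :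
    H ((u ^ n : CircleDeg1Liftˣ) x) = H x + n * τ := by
  have h : SemiconjBy H (u : CircleDeg1Lift)
      (CircleDeg1Lift.translate (Multiplicative.ofAdd τ) : CircleDeg1Liftˣ) := by
    refine CircleDeg1Lift.semiconjBy_iff_semiconj.2 fun x => ?_
    rw [hH, CircleDeg1Lift.translate_apply, add_comm]
  have h1 := CircleDeg1Lift.semiconjBy_iff_semiconj.1 (h.units_zpow_right n) x
  rwa [CircleDeg1Lift.translate_zpow, CircleDeg1Lift.translate_apply, add_comm] at h1

/-- Dirichlet's theorem; the denominator exceeds `N` because rationals of denominator at most `N`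
keep a positive distance `ε` from `τ`. -/
theorem exists_coprime_approx {τ : ℝ} (hτ : Irrational τ) (N : ℕ) :
    ∃ (p : ℤ) (q : ℕ), N < q ∧ IsCoprime p q ∧ |τ - p / q| < 1 / (q : ℝ) ^ 2 := by
  obtain ⟨ε, hle, hε⟩ := ((eventually_nhdsWithin_of_eventually_nhds (s := Set.Ioi 0)
    (hτ.eventually_forall_le_dist_cast_rat_of_den_le N)).and self_mem_nhdsWithin).exists
  obtain ⟨n, hn⟩ := exists_nat_one_div_lt hε
  obtain ⟨r, hr, hrn⟩ := Real.exists_rat_abs_sub_le_and_den_le τ n.succ_pos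
  have hden : (0 : ℝ) < r.den := by exact_mod_cast r.den_pos
  have hden1 : (1 : ℝ) ≤ r.den := by exact_mod_cast r.den_pos
  have hrn' : (r.den : ℝ) ≤ n + 1 := by exact_mod_cast hrn
  have hcast : (r : ℝ) = r.num / r.den := Rat.cast_def r
  refine ⟨r.num, r.den, ?_, Rat.isCoprime_num_den r, ?_⟩
  · by_contra! h
    have h1 := hle r h
    rw [Real.dist_eq] at h1
    have h2 : 1 / (((n.succ : ℕ) + 1 : ℝ) * r.den) ≤ 1 / ((n : ℝ) + 1) := by
      apply one_div_le_one_div_of_le (by positivity)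
      push_cast
      nlinarith
    linarith
  · rw [← hcast]
    refine hr.trans_lt (one_div_lt_one_div_of_lt (by positivity) ?_)
    push_cast
    nlinarith

/-- For times below `q`, rotation by `τ` shadows rotation by `p / q` up to one step of the grid `1 /
q`. -/
theorem abs_mul_sub_lt_of_approx {τ : ℝ} {p : ℤ} {q : ℕ} (hq : 0 < q)
    (h : |τ - p / q| < 1 / (q : ℝ) ^ 2) {k : ℤ} (hk : |k| < q) :
    |k * τ - k * p / q| < 1 / q := by
  have hq' : (0 : ℝ) < q := by exact_mod_cast hq
  have hk' : |(k : ℝ)| ≤ q := by exact_mod_cast hk.le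
  have e : (k : ℝ) * τ - k * p / q = k * (τ - p / q) := by ring
  rw [e, abs_mul]
  calc |(k : ℝ)| * |τ - p / q| ≤ q * |τ - p / q| :=
        mul_le_mul_of_nonneg_right hk' (abs_nonneg _)
    _ < q * (1 / (q : ℝ) ^ 2) := mul_lt_mul_of_pos_left h hq'
    _ = 1 / q := by field_simp

theorem exists_residue {p : ℤ} {q : ℕ} (hq : 0 < q) (hpq : IsCoprime p q) (r : ℤ) :
    ∃ s : ℕ, s < q ∧ ∃ m : ℤ, s * p = r + q * m := by
  obtain ⟨a, b, hab⟩ := hpq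
  have hq' : (0 : ℤ) < q := by exact_mod_cast hq
  have h0 := Int.emod_nonneg (r * a) hq'.ne'
  have h1 := Int.emod_lt_of_pos (r * a) hq'
  refine ⟨((r * a) % q).toNat, by omega, -(r * b) - (r * a) / q * p, ?_⟩
  rw [Int.toNat_of_nonneg h0, Int.emod_def]
  linear_combination r * hab

theorem eq_of_emod_mul_eq {p : ℤ} {q : ℕ} (hpq : IsCoprime p q) {k k' : ℕ} (hk : k < q)
    (hk' : k' < q) (h : (k * p : ℤ) % q = (k' * p) % q) : k = k' := by
  have h1 : (q : ℤ) ∣ (k - k') * p := by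
    rw [sub_mul]; exact Int.ModEq.dvd (Eq.symm h)
  have h2 : (q : ℤ) ∣ k - k' := hpq.symm.dvd_of_dvd_mul_right h1
  have h3 := Int.eq_zero_of_abs_lt_dvd h2 (by rw [abs_lt]; omega)
  omega

/-! ### Total distortion along the orbit of an arc. -/

theorem logDistortion_sub_int (u : CircleDeg1Lift) (m : ℤ) (a b c d : ℝ) :
    logDistortion u (a - m) (b - m) (c - m) (d - m) = logDistortion u a b c d := by
  simp only [logDistortion, crossRatio, CircleDeg1Lift.map_sub_int, sub_sub_sub_cancel_right]

theorem sum_logDistortion_zpow (u : CircleDeg1Liftˣ) {a b c d : ℝ} (hab : a < b) (hbc : b < c)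
    (hcd : c < d) (s : ℕ) :
    ∑ k ∈ Finset.range s, logDistortion u ((u ^ (k : ℤ) : CircleDeg1Liftˣ) a)
      ((u ^ (k : ℤ) : CircleDeg1Liftˣ) b) ((u ^ (k : ℤ) : CircleDeg1Liftˣ) c)
      ((u ^ (k : ℤ) : CircleDeg1Liftˣ) d) =
    Real.log (crossRatio ((u ^ (s : ℤ) : CircleDeg1Liftˣ) a) ((u ^ (s : ℤ) : CircleDeg1Liftˣ) b)
      ((u ^ (s : ℤ) : CircleDeg1Liftˣ) c) ((u ^ (s : ℤ) : CircleDeg1Liftˣ) d)) -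
    Real.log (crossRatio a b c d) := by
  have h := Finset.sum_range_sub (fun k : ℕ => Real.log (crossRatio
    ((u ^ (k : ℤ) : CircleDeg1Liftˣ) a) ((u ^ (k : ℤ) : CircleDeg1Liftˣ) b)
    ((u ^ (k : ℤ) : CircleDeg1Liftˣ) c) ((u ^ (k : ℤ) : CircleDeg1Liftˣ) d))) s
  have h0 : ∀ x, ((u ^ ((0 : ℕ) : ℤ) : CircleDeg1Liftˣ) : ℝ → ℝ) x = x := fun x => by simp
  simp only [h0] at h
  rw [← h]
  refine Finset.sum_congr rfl fun k _ => ?_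
  have hu := strictMono_unit (u ^ (k : ℤ))
  have hs : ∀ x, (u ^ ((k + 1 : ℕ) : ℤ) : CircleDeg1Liftˣ) x =
      u ((u ^ (k : ℤ) : CircleDeg1Liftˣ) x) := fun x => by
    rw [Nat.cast_add, Nat.cast_one, add_comm, zpow_add, zpow_one, Units.val_mul,
      CircleDeg1Lift.mul_apply]
  rw [logDistortion_eq_sub (strictMono_unit u) (hu hab) (hu hbc) (hu hcd)]
  simp only [hs]

/-- Iterates of an arc that is short with respect to the `q`-th closest return cover the circle
a bounded number of times, so that the total distortion along them is bounded. -/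
theorem sum_logDistortion_zpow_le {u : CircleDeg1Liftˣ} {H : CircleDeg1Lift} {τ B : ℝ}
    (hH : ∀ x, H (u x) = H x + τ) (hB : liftVariation u ≤ B) {p : ℤ} {q : ℕ} (hq : 6 ≤ q)
    (hpq : IsCoprime p q) (happ : |τ - p / q| < 1 / (q : ℝ) ^ 2) {a b c d : ℝ} (hab : a < b)
    (hbc : b < c) (hcd : c < d) (ha : H b - 2 / q < H a) (hd : H d < H b + 2 / q) {s : ℕ}
    (hs : s ≤ q) :
    ∑ k ∈ Finset.range s, logDistortion u ((u ^ (k : ℤ) : CircleDeg1Liftˣ) a)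
      ((u ^ (k : ℤ) : CircleDeg1Liftˣ) b) ((u ^ (k : ℤ) : CircleDeg1Liftˣ) c)
      ((u ^ (k : ℤ) : CircleDeg1Liftˣ) d) ≤ 12 * B := by
  have hq' : (0 : ℝ) < q := by exact_mod_cast (by omega : 0 < q)
  have hqz : (0 : ℤ) < q := by exact_mod_cast (by omega : 0 < q)
  set r : ℕ → ℕ := fun k => ((k * p : ℤ) % q).toNat with hr
  set m : ℕ → ℤ := fun k => (k * p : ℤ) / q with hm
  have hrz : ∀ k : ℕ, (r k : ℤ) = (k * p : ℤ) % q := fun k =>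
    Int.toNat_of_nonneg (Int.emod_nonneg _ hqz.ne')
  have hrlt : ∀ k, r k < q := fun k => by
    have h := hrz k
    have h1 := Int.emod_lt_of_pos (k * p : ℤ) hqz
    omega
  have hrinj : ∀ k k', k < q → k' < q → r k = r k' → k = k' := fun k k' hk hk' h =>
    eq_of_emod_mul_eq hpq hk hk' (by rw [← hrz, ← hrz, h])
  have hpos : ∀ k : ℕ, k < q → |(k * τ - m k) - r k / q| < 1 / q := fun k hk => by
    have h1 := abs_mul_sub_lt_of_approx (by omega) happ (k := k) (by rw [abs_lt]; omega)
    have h2 : (k * p : ℝ) = r k + q * m k := by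
      have : (k * p : ℤ) = r k + q * m k := by rw [hrz]; exact (Int.emod_add_mul_ediv _ _).symm
      exact_mod_cast this
    rw [Int.cast_natCast, h2] at h1
    convert h1 using 2
    field_simp
    ring
  -- In the `H` coordinate the `k`-th arc lies within `3 / q` of `H b + r k / q`, so residues at
  -- least 6 apart give disjoint arcs. Classes modulo 6 work up to `q - 6`; the last five residues
  -- get a colour each, to avoid overlaps across the wrap.
  set col : ℕ → ℕ := fun k => if r k + 6 ≤ q then r k % 6 else 6 + (q - r k - 1) with hcol
  have hcol12 : ∀ k ∈ Finset.range s, col k ∈ Finset.range 12 := fun k _ => by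
    have := hrlt k
    simp only [hcol, Finset.mem_range]
    split_ifs <;> omega
  rw [← Finset.sum_fiberwise_of_maps_to hcol12]
  have key : ∀ j ∈ Finset.range 12, ∑ k ∈ Finset.range s with col k = j,
      logDistortion u ((u ^ (k : ℤ) : CircleDeg1Liftˣ) a)
      ((u ^ (k : ℤ) : CircleDeg1Liftˣ) b) ((u ^ (k : ℤ) : CircleDeg1Liftˣ) c)
      ((u ^ (k : ℤ) : CircleDeg1Liftˣ) d) ≤ B := by
    intro j _
    have hlow : ∀ k < q, H b + (r k - 3) / q < H ((u ^ (k : ℤ) : CircleDeg1Liftˣ) a - m k) :=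
      fun k hk => by
        rw [CircleDeg1Lift.map_sub_int, semiconj_zpow hH, Int.cast_natCast]
        have h1 := (abs_lt.1 (hpos k hk)).1
        have h2 : ((r k : ℝ) - 3) / q = r k / q - 2 / q - 1 / q := by ring
        linarith
    have hupp : ∀ k < q, H ((u ^ (k : ℤ) : CircleDeg1Liftˣ) d - m k) < H b + (r k + 3) / q :=
      fun k hk => by
        rw [CircleDeg1Lift.map_sub_int, semiconj_zpow hH, Int.cast_natCast]
        have h1 := (abs_lt.1 (hpos k hk)).2
        have h2 : ((r k : ℝ) + 3) / q = r k / q + 2 / q + 1 / q := by ring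
        linarith
    have horder : ∀ k < q, ∀ k' < q, r k + 6 ≤ r k' →
        (u ^ (k : ℤ) : CircleDeg1Liftˣ) d - m k ≤ (u ^ (k' : ℤ) : CircleDeg1Liftˣ) a - m k' :=
      fun k hk k' hk' h => by
        refine (H.monotone.reflect_lt ?_).le
        have h1 : ((r k : ℝ) + 3) / q ≤ (r k' - 3) / q := by
          have : (r k : ℝ) + 6 ≤ r k' := by exact_mod_cast h
          gcongr
          linarith
        linarith [hlow k' hk', hupp k hk]
    have hwrap : ∀ k < q, ∀ k' < q, r k + 6 ≤ r k' + q →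
        (u ^ (k : ℤ) : CircleDeg1Liftˣ) d - m k ≤
          (u ^ (k' : ℤ) : CircleDeg1Liftˣ) a - m k' + 1 :=
      fun k hk k' hk' h => by
        refine (H.monotone.reflect_lt ?_).le
        rw [H.map_add_one]
        have h1 : ((r k : ℝ) + 3) / q ≤ (r k' - 3) / q + 1 := by
          have : (r k : ℝ) + 6 ≤ r k' + q := by exact_mod_cast h
          rw [div_add_one hq'.ne', div_le_div_iff_of_pos_right hq']
          linarith
        linarith [hlow k' hk', hupp k hk]
    have hsum := sum_logDistortion_le_of_disjoint (strictMono_unit u) hB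
      (fun k : ℕ => (u ^ (k : ℤ) : CircleDeg1Liftˣ) a - m k)
      (fun k : ℕ => (u ^ (k : ℤ) : CircleDeg1Liftˣ) b - m k)
      (fun k : ℕ => (u ^ (k : ℤ) : CircleDeg1Liftˣ) c - m k)
      (fun k : ℕ => (u ^ (k : ℤ) : CircleDeg1Liftˣ) d - m k)
      {k ∈ Finset.range s | col k = j} ?_ ?_ ?_
    · simpa only [logDistortion_sub_int] using hsum
    · intro k _
      have hu := strictMono_unit (u ^ (k : ℤ))
      exact ⟨sub_lt_sub_right (hu hab) _, sub_lt_sub_right (hu hbc) _,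
        sub_lt_sub_right (hu hcd) _⟩
    · intro k hk k' hk'
      simp only [Finset.mem_filter, Finset.mem_range, hcol] at hk hk'
      refine hwrap k (by omega) k' (by omega) ?_
      have h1 := hrlt k
      have h2 := hrlt k'
      obtain ⟨-, hk⟩ := hk
      obtain ⟨-, hk'⟩ := hk'
      split_ifs at hk hk' <;> omega
    · intro k hk k' hk' hne
      simp only [Finset.mem_filter, Finset.mem_range, hcol] at hk hk'
      have hne' : r k ≠ r k' := fun h => hne (hrinj k k' (by omega) (by omega) h)
      have h1 := hrlt k
      have h2 := hrlt k'
      rcases lt_or_gt_of_ne hne' with h | h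
      · refine Or.inl (horder k (by omega) k' (by omega) ?_)
        obtain ⟨-, hk⟩ := hk
        obtain ⟨-, hk'⟩ := hk'
        split_ifs at hk hk' <;> omega
      · refine Or.inr (horder k' (by omega) k (by omega) ?_)
        obtain ⟨-, hk⟩ := hk
        obtain ⟨-, hk'⟩ := hk'
        split_ifs at hk hk' <;> omega
  simpa using Finset.sum_le_sum key

/-! ### Definite space beside plateaus, and injectivity. -/

/-- The extreme case is that of three equal adjacent intervals. -/
theorem crossRatio_le_three {a b c d : ℝ} (hbc : b < c) (h1 : c - b ≤ b - a)
    (h2 : c - b ≤ d - c) : crossRatio a b c d ≤ 3 := by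
  have hx : 0 < c - b := sub_pos.2 hbc
  have hl : 0 < b - a := by linarith
  have hr : 0 < d - c := by linarith
  unfold crossRatio
  rw [div_le_iff₀ (by positivity)]
  nlinarith [mul_nonneg (sub_nonneg.2 h1) (sub_nonneg.2 h2), mul_nonneg hx.le (sub_nonneg.2 h1),
    mul_nonneg hx.le (sub_nonneg.2 h2)]

/-- Around an arc on which the semiconjugacy is constant there is definite space, at the scale of
every rational approximation of the rotation number. -/
theorem exists_definite_space {u : CircleDeg1Liftˣ} {H : CircleDeg1Lift} {τ B : ℝ}
    (hH : ∀ x, H (u x) = H x + τ) (hB : liftVariation u ≤ B) {p : ℤ} {q : ℕ} (hq : 6 ≤ q)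
    (hpq : IsCoprime p q) (happ : |τ - p / q| < 1 / (q : ℝ) ^ 2) {b c : ℝ} (hbc : b < c)
    (hbcH : H b = H c) :
    ∃ a < b, H b - 2 / q < H a ∧ c - b ≤ 3 * Real.exp (12 * B) * (b - a) := by
  have hq0 : 0 < q := by omega
  have hq' : (0 : ℝ) < q := by exact_mod_cast hq0
  obtain ⟨s, hs, hmin⟩ := (Finset.range q).exists_min_image
    (fun k : ℕ => (u ^ (-k : ℤ) : CircleDeg1Liftˣ) c - (u ^ (-k : ℤ) : CircleDeg1Liftˣ) b)
    ⟨0, by simpa using hq0⟩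
  rw [Finset.mem_range] at hs
  -- The neighbours of the shortest iterate: a residue differing by `±1` shifts `H` by `∓1 / q` with
  -- error below `1 / q`, hence strictly to one side and by less than `2 / q`.
  obtain ⟨s₁, hs₁, m₁, hm₁⟩ := exists_residue hq0 hpq (s * p + 1)
  obtain ⟨s₂, hs₂, m₂, hm₂⟩ := exists_residue hq0 hpq (s * p - 1)
  have shift : ∀ (t : ℕ) (m e : ℤ), t < q → (t * p : ℤ) = s * p + e + q * m →
      |((s - t : ℝ) * τ + m) - (-e / q)| < 1 / q := fun t m e ht h => by
    have h1 := abs_mul_sub_lt_of_approx hq0 happ (k := s - t) (by rw [abs_lt]; omega)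
    have h2 : (t * p : ℝ) = s * p + e + q * m := by exact_mod_cast h
    push_cast at h1
    convert h1 using 2
    field_simp
    linear_combination -h2
  have hd1 := shift s₁ m₁ 1 hs₁ hm₁
  have hd2 := shift s₂ m₂ (-1) hs₂ (by rw [hm₂]; ring)
  push_cast at hd1 hd2
  rw [neg_neg, abs_lt] at hd2
  rw [neg_div, abs_lt] at hd1
  have e2 : (2 : ℝ) / q = 1 / q + 1 / q := by ring
  set b' := (u ^ (-s : ℤ) : CircleDeg1Liftˣ) b with hb'
  set c' := (u ^ (-s : ℤ) : CircleDeg1Liftˣ) c with hc'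
  set a' := (u ^ (-s₁ : ℤ) : CircleDeg1Liftˣ) b + m₁ with ha'
  set d' := (u ^ (-s₂ : ℤ) : CircleDeg1Liftˣ) c + m₂ with hd'
  have hb'H : H b' = H b - s * τ := by
    rw [hb', semiconj_zpow hH]; push_cast; ring
  have hc'H : H c' = H b - s * τ := by
    rw [hc', semiconj_zpow hH, hbcH]; push_cast; ring
  have hleft : ∀ x, H x = H b →
      H ((u ^ (-s₁ : ℤ) : CircleDeg1Liftˣ) x + m₁) = H b' + ((s - s₁ : ℝ) * τ + m₁) :=
    fun x hx => by
      rw [CircleDeg1Lift.map_add_int, semiconj_zpow hH, hb'H, hx]; push_cast; ring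
  have hright : ∀ x, H x = H b →
      H ((u ^ (-s₂ : ℤ) : CircleDeg1Liftˣ) x + m₂) = H b' + ((s - s₂ : ℝ) * τ + m₂) :=
    fun x hx => by
      rw [CircleDeg1Lift.map_add_int, semiconj_zpow hH, hb'H, hx]; push_cast; ring
  have hb'c' : b' < c' := strictMono_unit _ hbc
  have hlb : (u ^ (-s₁ : ℤ) : CircleDeg1Liftˣ) c + m₁ < b' := by
    refine H.monotone.reflect_lt ?_
    rw [hleft c hbcH.symm]; linarith
  have hrc : c' < (u ^ (-s₂ : ℤ) : CircleDeg1Liftˣ) b + m₂ := by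
    refine H.monotone.reflect_lt ?_
    rw [hright b rfl, hc'H, ← hb'H]; linarith
  have hspace1 : c' - b' ≤ b' - a' := by
    have := hmin s₁ (Finset.mem_range.2 hs₁)
    linarith
  have hspace2 : c' - b' ≤ d' - c' := by
    have := hmin s₂ (Finset.mem_range.2 hs₂)
    linarith
  have hab' : a' < b' := by linarith
  have hcd' : c' < d' := by linarith
  have ha'H : H b' - 2 / q < H a' := by
    rw [ha', hleft b rfl]; linarith
  have hd'H : H d' < H b' + 2 / q := by
    rw [hd', hright c hbcH.symm]; linarith
  have hsum := sum_logDistortion_zpow_le hH hB hq hpq happ hab' hb'c' hcd' ha'H hd'H hs.le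
  rw [sum_logDistortion_zpow u hab' hb'c' hcd'] at hsum
  have hinv : ∀ x, (u ^ (s : ℤ) : CircleDeg1Liftˣ) ((u ^ (-s : ℤ) : CircleDeg1Liftˣ) x) = x :=
    fun x => by
      rw [← CircleDeg1Lift.mul_apply, ← Units.val_mul, ← zpow_add, add_neg_cancel, zpow_zero]
      rfl
  have hmono := strictMono_unit (u ^ (s : ℤ))
  have hab := hmono hab'
  have hcd := hmono hcd'
  rw [hb', hinv] at hab
  rw [hc', hinv] at hcd
  rw [hb', hc', hinv, hinv, ← hb', ← hc'] at hsum
  set a := (u ^ (s : ℤ) : CircleDeg1Liftˣ) a' with ha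
  set d := (u ^ (s : ℤ) : CircleDeg1Liftˣ) d' with hd
  refine ⟨a, hab, ?_, ?_⟩
  · rw [ha, semiconj_zpow hH, Int.cast_natCast]
    linarith
  · have hcr := crossRatio_pos hab' hb'c' hcd'
    have h3 := Real.log_le_log hcr (crossRatio_le_three hb'c' hspace1 hspace2)
    have h4 : crossRatio a b c d ≤ 3 * Real.exp (12 * B) := by
      rw [← Real.log_le_log_iff (crossRatio_pos hab hbc hcd) (by positivity),
        Real.log_mul (by norm_num) (Real.exp_pos _).ne', Real.log_exp]
      linarith
    unfold crossRatio at h4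
    have hba : 0 < b - a := sub_pos.2 hab
    have hdc : 0 < d - c := sub_pos.2 hcd
    have hda : 0 < d - a := by linarith
    rw [div_le_iff₀ (by positivity)] at h4
    -- Replacing `d - c` by the larger `d - a` lets that factor cancel.
    have h5 : (c - b) * (d - a) ≤ 3 * Real.exp (12 * B) * (b - a) * (d - a) := by
      refine h4.trans ?_
      rw [← mul_assoc]
      exact mul_le_mul_of_nonneg_left (by linarith) (by positivity)
    exact le_of_mul_le_mul_right h5 hda

/-- A bound on the cross ratio distortion makes the semiconjugacy injective. -/
theorem injective_of_liftVariation_le {u : CircleDeg1Liftˣ} {H : CircleDeg1Lift} {τ B : ℝ}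
    (hHc : Continuous H) (hτ : Irrational τ) (hH : ∀ x, H (u x) = H x + τ)
    (hB : liftVariation u ≤ B) : Function.Injective H := by
  by_contra hinj
  obtain ⟨x₁, x₂, hx, hlt⟩ : ∃ x₁ x₂, H x₁ = H x₂ ∧ x₁ < x₂ := by
    simp only [Function.Injective, not_forall] at hinj
    obtain ⟨x, y, h, hne⟩ := hinj
    rcases lt_or_gt_of_ne hne with h1 | h1
    · exact ⟨x, y, h, h1⟩
    · exact ⟨y, x, h.symm, h1⟩
  set S := {x | H x = H x₁} with hS
  have hbdd : BddBelow S := ⟨x₁ - 1, fun x hx => by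
    refine (H.monotone.reflect_lt ?_).le
    have h := H.map_sub_int x₁ 1
    push_cast at h
    rw [h, show H x = H x₁ from hx]
    linarith⟩
  have hmem : sInf S ∈ S := (isClosed_eq hHc continuous_const).csInf_mem ⟨x₁, rfl⟩ hbdd
  have hle : sInf S ≤ x₁ := csInf_le hbdd rfl
  set b := sInf S with hb
  have hbH : H b = H x₁ := hmem
  have hbc : b < x₂ := hle.trans_lt hlt
  set K := 3 * Real.exp (12 * B) with hK
  have hK0 : 0 < K := by positivity
  -- A point left of the plateau, so `H a₀ < H b`; any `a` in `(a₀, b)` is too close to `b` for the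
  -- definite space bound.
  set a₀ := b - (x₂ - b) / (2 * K) with ha₀
  have hpos : 0 < (x₂ - b) / (2 * K) := div_pos (sub_pos.2 hbc) (by positivity)
  have ha₀H : H a₀ < H b := by
    refine lt_of_le_of_ne (H.monotone (by linarith)) fun h => ?_
    have : b ≤ a₀ := csInf_le hbdd (h.trans hbH)
    linarith
  obtain ⟨N, hN⟩ := exists_nat_gt (2 / (H b - H a₀))
  obtain ⟨p, q, hNq, hpq, happ⟩ := exists_coprime_approx hτ (N + 6)
  obtain ⟨a, hab, haH, hKa⟩ := exists_definite_space hH hB (by omega) hpq happ hbc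
    (hbH.trans hx)
  have hq' : (0 : ℝ) < q := by exact_mod_cast (by omega : 0 < q)
  have hNq' : (N : ℝ) < q := by exact_mod_cast (by omega : N < q)
  have h1 : 2 / (q : ℝ) < H b - H a₀ := by
    rw [div_lt_comm₀ hq' (sub_pos.2 ha₀H)]
    linarith
  have h2 : a₀ < a := H.monotone.reflect_lt (by linarith)
  have h3 : K * (b - a) < x₂ - b := by
    calc K * (b - a) ≤ K * ((x₂ - b) / (2 * K)) :=
          mul_le_mul_of_nonneg_left (by linarith) hK0.le
      _ = (x₂ - b) / 2 := by field_simp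
      _ < x₂ - b := by linarith
  linarith

/-! ### Passage between the line and the circle. -/

theorem IsLift.bijective {F : CircleDeg1Lift} {f : UnitAddCircle ≃ₜ UnitAddCircle}
    (hF : IsLift F f) : Function.Bijective F := by
  refine ⟨fun x y hxy => ?_, F.continuous_iff_surjective.1 hF.continuous⟩
  have h1 : (x : UnitAddCircle) = y :=
    f.injective (by rw [← hF.coe_apply, ← hF.coe_apply, hxy])
  have h2 : ((x - y : ℝ) : UnitAddCircle) = 0 := by rw [AddCircle.coe_sub, h1, sub_self]
  obtain ⟨m, hm⟩ := (AddCircle.coe_eq_zero_iff (1 : ℝ)).1 h2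
  have hm : x = y + m := by
    have : (m : ℝ) = x - y := by simpa using hm
    linarith
  rw [hm, F.map_add_int] at hxy
  rw [hm]
  linarith

theorem isIrrational_coe_iff {τ : ℝ} : IsIrrational (τ : UnitAddCircle) ↔ Irrational τ := by
  refine ⟨fun ⟨α, hα, h⟩ => ?_, fun h => ⟨τ, h, rfl⟩⟩
  have h2 : ((τ - α : ℝ) : UnitAddCircle) = 0 := by rw [AddCircle.coe_sub, h, sub_self]
  obtain ⟨m, hm⟩ := (AddCircle.coe_eq_zero_iff (1 : ℝ)).1 h2
  have : τ = α + m := by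
    have : (m : ℝ) = τ - α := by simpa using hm
    linarith
  rw [this]
  exact hα.add_intCast m

theorem dense_int_mul_add_int {τ : ℝ} (hτ : Irrational τ) :
    Dense {g : ℝ | ∃ k m : ℤ, g = k * τ + m} := by
  have h : Dense (AddSubgroup.closure {τ, 1} : Set ℝ) :=
    dense_addSubgroupClosure_pair_iff.2 (by rwa [div_one])
  refine h.mono fun g hg => ?_
  obtain ⟨k, m, h⟩ := AddSubgroup.mem_closure_pair.1 hg
  exact ⟨k, m, by simpa using h.symm⟩

/-- A semiconjugacy to an irrational rotation is continuous. -/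
theorem continuous_of_semiconj {u : CircleDeg1Liftˣ} {H : CircleDeg1Lift} {τ : ℝ}
    (hτ : Irrational τ) (hH : ∀ x, H (u x) = H x + τ) : Continuous H := by
  refine H.monotone.continuous_of_denseRange ?_
  -- The range of `H` contains the dense set `H 0 + ℤτ + ℤ`, and a monotone map with dense range is
  -- continuous.
  have h := (Homeomorph.addLeft (H 0)).surjective.denseRange.dense_image
    (Homeomorph.addLeft (H 0)).continuous (dense_int_mul_add_int hτ)
  refine h.mono ?_
  rintro _ ⟨_, ⟨k, m, rfl⟩, rfl⟩
  refine ⟨(u ^ k : CircleDeg1Liftˣ) 0 + m, ?_⟩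
  rw [CircleDeg1Lift.map_add_int, semiconj_zpow hH]
  simp [add_assoc]

theorem exists_homeomorph_of_injective {H : CircleDeg1Lift} (hc : Continuous H)
    (hi : Function.Injective H) :
    ∃ h : UnitAddCircle ≃ₜ UnitAddCircle, ∀ x : ℝ, h (x : UnitAddCircle) = (H x : ℝ) := by
  have hper : Function.Periodic (fun x : ℝ => ((H x : ℝ) : UnitAddCircle)) 1 := fun x => by
    simp only [H.map_add_one]
    exact AddCircle.coe_add_period 1 _
  set g : UnitAddCircle → UnitAddCircle := hper.lift with hg
  have hgc : ∀ x : ℝ, g (x : UnitAddCircle) = (H x : ℝ) := fun x => hper.lift_coe x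
  have hcont : Continuous g := by
    refine isQuotientMap_quotient_mk'.continuous_iff.2 ?_
    exact (AddCircle.continuous_mk' (1 : ℝ)).comp hc
  have hbij : Function.Bijective g := by
    constructor
    · intro a b hab
      obtain ⟨x, rfl⟩ := QuotientAddGroup.mk_surjective a
      obtain ⟨y, rfl⟩ := QuotientAddGroup.mk_surjective b
      change g (x : UnitAddCircle) = g (y : UnitAddCircle) at hab
      rw [hgc, hgc] at hab
      have h2 : ((H x - H y : ℝ) : UnitAddCircle) = 0 := by rw [AddCircle.coe_sub, hab, sub_self]
      obtain ⟨m, hm⟩ := (AddCircle.coe_eq_zero_iff (1 : ℝ)).1 h2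
      have hm' : (m : ℝ) = H x - H y := by simpa using hm
      have hxy : x = y + m := hi (by rw [H.map_add_int]; linarith)
      have h0 : ((m : ℝ) : UnitAddCircle) = 0 :=
        (AddCircle.coe_eq_zero_iff (1 : ℝ)).2 ⟨m, by simp⟩
      change (x : UnitAddCircle) = (y : UnitAddCircle)
      rw [hxy, AddCircle.coe_add, h0, add_zero]
    · intro a
      obtain ⟨y, rfl⟩ := QuotientAddGroup.mk_surjective a
      obtain ⟨x, hx⟩ := H.continuous_iff_surjective.1 hc y
      exact ⟨(x : UnitAddCircle), hx ▸ hgc x⟩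
  exact ⟨Continuous.homeoOfEquivCompactToT2 (f := Equiv.ofBijective g hbij) hcont, hgc⟩

theorem coe_zpow_apply {f : UnitAddCircle ≃ₜ UnitAddCircle} {u : CircleDeg1Liftˣ}
    (hu : ∀ x : ℝ, ((u x : ℝ) : UnitAddCircle) = f x) (k : ℤ) :
    ∀ z : ℝ, (((u ^ k : CircleDeg1Liftˣ) z : ℝ) : UnitAddCircle) =
      (f ^ k : UnitAddCircle ≃ₜ UnitAddCircle) (z : UnitAddCircle) := by
  induction k using Int.induction_on with
  | zero => intro z; simp
  | succ n ih =>
    intro z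
    rw [zpow_add_one, zpow_add_one, Units.val_mul, CircleDeg1Lift.mul_apply, ih, hu]
    rfl
  | pred n ih =>
    intro z
    rw [zpow_sub_one, zpow_sub_one, Units.val_mul, CircleDeg1Lift.mul_apply, ih]
    have h : (((u⁻¹ : CircleDeg1Liftˣ) z : ℝ) : UnitAddCircle) = f.symm (z : UnitAddCircle) := by
      rw [Homeomorph.eq_symm_apply, ← hu, CircleDeg1Lift.units_apply_inv_apply]
    rw [h]
    rfl

theorem not_isWanderingInterval_of_injective {f : UnitAddCircle ≃ₜ UnitAddCircle}
    {u : CircleDeg1Liftˣ} (hu : ∀ x : ℝ, ((u x : ℝ) : UnitAddCircle) = f x) {H : CircleDeg1Lift}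
    {τ : ℝ} (hτ : Irrational τ) (hH : ∀ x, H (u x) = H x + τ)
    (hi : Function.Injective H) (J : Set UnitAddCircle) : ¬ IsWanderingInterval f J := by
  rintro ⟨⟨I, hI, hnt, rfl⟩, hdis⟩
  obtain ⟨x, hx, y, hy, hxy⟩ := hnt.exists_lt
  have hHxy : H x < H y := H.monotone.strictMono_of_injective hi hxy
  -- The bound by 1 rules out `k = 0`; the other bound keeps the return of `x` between `x` and `y`.
  obtain ⟨_, ⟨k, m, rfl⟩, h0, h1⟩ := (dense_int_mul_add_int hτ).exists_between
    (lt_min one_pos (sub_pos.2 hHxy))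
  rw [lt_min_iff] at h1
  have hk : k ≠ 0 := by
    rintro rfl
    have h2 : (0 : ℝ) < m := by simpa using h0
    have h3 : (m : ℝ) < 1 := by simpa using h1.1
    have h2 : 0 < m := by exact_mod_cast h2
    have h3 : m < 1 := by exact_mod_cast h3
    omega
  have huk := coe_zpow_apply hu k
  set w := (u ^ k : CircleDeg1Liftˣ) x + m with hw
  have hHw : H w = H x + (k * τ + m) := by
    rw [hw, H.map_add_int, semiconj_zpow hH, add_assoc]
  have hxw : x < w := H.monotone.reflect_lt (by linarith)
  have hwy : w < y := H.monotone.reflect_lt (by linarith [h1.2])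
  have hwI : w ∈ I := hI.out hx hy ⟨hxw.le, hwy.le⟩
  refine Set.disjoint_left.1 (hdis k hk) ⟨_, ⟨x, hx, rfl⟩, rfl⟩ ⟨w, hwI, ?_⟩
  have h0 : ((m : ℝ) : UnitAddCircle) = 0 :=
    (AddCircle.coe_eq_zero_iff (1 : ℝ)).2 ⟨m, by simp⟩
  simp only
  rw [hw, AddCircle.coe_add, h0, add_zero, huk]

end CircleHomeo

theorem theorem2 (f : UnitAddCircle ≃ₜ UnitAddCircle)
    (hf : CircleHomeo.OrientationPreserving f)
    (hrot : CircleHomeo.IsIrrational (CircleHomeo.rotationNumber f hf))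
    (B : ℝ) (hB : CircleHomeo.logCrossRatioVariation f hf ≤ (B : EReal)) :
    (¬ ∃ J : Set UnitAddCircle, CircleHomeo.IsWanderingInterval f J) ∧
      ∃ θ : UnitAddCircle, CircleHomeo.IsIrrational θ ∧ CircleHomeo.ConjugateToRotation f θ := by
  obtain ⟨F, hF⟩ := id hf
  rw [CircleHomeo.rotationNumber_eq hf hF, CircleHomeo.isIrrational_coe_iff] at hrot
  rw [CircleHomeo.logCrossRatioVariation_eq hf hF] at hB
  obtain ⟨u, rfl⟩ := CircleDeg1Lift.isUnit_iff_bijective.2 hF.bijective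
  set τ := CircleDeg1Lift.translationNumber (u : CircleDeg1Lift)
  obtain ⟨H, hH⟩ := CircleDeg1Lift.units_semiconj_of_translationNumber_eq (f₁ := u)
    (f₂ := CircleDeg1Lift.translate (Multiplicative.ofAdd τ))
    (CircleDeg1Lift.translationNumber_translate τ).symm
  have hH : ∀ x, H (u x) = H x + τ := fun x => by
    rw [hH x, CircleDeg1Lift.translate_apply, add_comm]
  have hc := CircleHomeo.continuous_of_semiconj hrot hH
  have hi := CircleHomeo.injective_of_liftVariation_le hc hrot hH hB
  refine ⟨fun ⟨J, hJ⟩ => CircleHomeo.not_isWanderingInterval_of_injective hF.coe_apply hrot hH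
    hi J hJ, τ, CircleHomeo.isIrrational_coe_iff.2 hrot, ?_⟩
  obtain ⟨h, hh⟩ := CircleHomeo.exists_homeomorph_of_injective hc hi
  refine ⟨h, fun x => ?_⟩
  obtain ⟨x, rfl⟩ := QuotientAddGroup.mk_surjective x
  change h (f (x : UnitAddCircle)) = h (x : UnitAddCircle) + τ
  rw [← hF.coe_apply, hh, hh, hH, AddCircle.coe_add]
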